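/- Let $\mathbb T^n=(S^1)^n$. An $n$-dimensional simple polytope is the convex hull $P\subset\mathbb R^n$ of finitely many points, with nonempty interior, such that every vertex lies on exactly $n$ facets. An action of $\mathbb T^n$ on a smooth $2n$-manifold $M$ is locally standard if every point of $M$ has a $\mathbb T^n$-invariant open neighbourhood $U$ with a diffeomorphism $\psi$ of $U$ onto a $\mathbb T^n$-invariant open subset of $\mathbb C^n$ (with the coordinatewise action) and an automorphism $\delta$ of $\mathbb T^n$ such that $\psi(t\cdot x)=\delta(t)\cdot\psi(x)$ for all $t\in\mathbb T^n$, $x\in U$. A $2n$-dimensional quasitoric manifold is a closed, connected, orientable smooth $2n$-manifold $M$ with a smooth, locally standard $\mathbb T^n$-action, for which there are an $n$-dimensional simple polytope $P$ with $\partial P\neq\emptyset$ and a continuous surjection $\mathfrak q\colon M\to P$ whose fibres are exactly the $\mathbb T^n$-orbits and which maps every $l$-dimensional orbit to a point in the relative interior of an $l$-dimensional face of $P$. For a group $G$ acting on a topological space $X$, a $G$-invariant open set $U\subseteq X$ is $G$-categorical if there is a continuous map $H\colon U\times[0,1]\to X$ with $g\cdot H(x,t)=H(g\cdot x,t)$ and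 $H(x,0)=x$ for all $g\in G$, $x\in U$, $t\in[0,1]$, such that $H(U\times\{1\})$ is contained in a single $G$-orbit. The equivariant category $\mathrm{cat}_G(X)$ is the least $k$ such that $X$ is covered by $k$ $G$-categorical sets (and $\infty$ if there is no such $k$). Theorem. Let $M$ and $N$ be $2n$-dimensional quasitoric manifolds. Then the fixed point sets $M^{\mathbb T^n}$ and $N^{\mathbb T^n}$ are finite, and if $p$ and $q$ denote their numbers of points, then $$\mathrm{cat}_{\mathbb T^n}(M\times N)=pq,$$ where $\mathbb T^n$ acts diagonally on $M\times N$, that is, $t\cdot(x,y)=(t\cdot x,t\cdot y)$. -/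

import Mathlib

open scoped Manifold ContDiff

/-! ### Equivariant Lusternik-Schnirelmann category -/

/-- An invariant open subset `U` of the `G`-space `X` is `G`-categorical if there is a `G`-homotopy
`H : U × [0,1] → X` which starts at the inclusion and ends inside a single orbit. -/
structure IsGCategorical (G : Type*) [Group G] {X : Type*} [TopologicalSpace X] [MulAction G X]
    (U : Set X) : Prop where
  isOpen : IsOpen U
  invariant : ∀ g : G, ∀ x ∈ U, g • x ∈ U
  exists_homotopy : ∃ H : C(U × unitInterval, X),
    (∀ (g : G) (x : U) (t : unitInterval),
      g • H (x, t) = H (⟨g • (x : X), invariant g x x.2⟩, t)) ∧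
    (∀ x : U, H (x, 0) = x) ∧
    ∃ z : X, ∀ x : U, H (x, 1) ∈ MulAction.orbit G z

/-- The equivariant category `cat_G(X)`: the least `k` such that `X` is covered by `k`
`G`-categorical subsets, and `⊤` if there is no such `k`. -/
noncomputable def equivariantCat (G : Type*) [Group G] (X : Type*) [TopologicalSpace X]
    [MulAction G X] : ℕ∞ :=
  sInf {m : ℕ∞ | ∃ k : ℕ, m = k ∧ ∃ U : Fin k → Set X,
    (∀ i, IsGCategorical G (U i)) ∧ ⋃ i, U i = Set.univ}

/-! ### Simple polytopes -/

section Polytope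

variable {E : Type*} [NormedAddCommGroup E] [NormedSpace ℝ E]

/-- The dimension of a (nonempty) convex set is the dimension of its affine span. -/
noncomputable def convexDim (F : Set E) : ℕ := Module.finrank ℝ (vectorSpan ℝ F)

/-- The nonempty faces of a polytope `P`: the sets of maximizers on `P` of linear functionals
(the zero functional gives `P` itself). -/
def IsPolytopeFace (P F : Set E) : Prop := F.Nonempty ∧ IsExposed ℝ P F

/-- A facet of `P` is a face whose dimension is one less than that of `P`. -/
def IsPolytopeFacet (P F : Set E) : Prop :=
  IsPolytopeFace P F ∧ convexDim F + 1 = convexDim P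

end Polytope

/-- `P` is an `n`-dimensional simple polytope in `ℝⁿ`: it is the convex hull of finitely many
points, it has nonempty interior, and each of its vertices lies on exactly `n` facets. -/
structure IsSimplePolytope (n : ℕ) (P : Set (EuclideanSpace ℝ (Fin n))) : Prop where
  exists_finite : ∃ s : Set (EuclideanSpace ℝ (Fin n)), s.Finite ∧ P = convexHull ℝ s
  interior_nonempty : (interior P).Nonempty
  simple : ∀ v ∈ P.extremePoints ℝ, {F | IsPolytopeFacet P F ∧ v ∈ F}.encard = n

/-! ### Torus actions -/

/-- The compact torus `𝕋ⁿ = (S¹)ⁿ`. -/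
abbrev Torus (n : ℕ) : Type := Fin n → Circle

/-- The Lie algebra of the isotropy group of `x`: all `v ∈ ℝⁿ = Lie(𝕋ⁿ)` whose one-parameter
subgroup `s ↦ (e^{i s v₁}, …, e^{i s vₙ})` fixes `x`. -/
noncomputable def isotropyLieAlgebra {n : ℕ} {M : Type*} [MulAction (Torus n) M] (x : M) :
    Submodule ℝ (Fin n → ℝ) where
  carrier := {v | ∀ s : ℝ, (fun i => Circle.exp (s * v i) : Torus n) • x = x}
  zero_mem' := by
    intro s
    have h : (fun i => Circle.exp (s * (0 : Fin n → ℝ) i) : Torus n) = 1 := by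
      funext i
      simp
    rw [h, one_smul]
  add_mem' := by
    intro v w hv hw s
    have h : (fun i => Circle.exp (s * (v + w) i) : Torus n) =
        (fun i => Circle.exp (s * v i) : Torus n) * (fun i => Circle.exp (s * w i) : Torus n) := by
      funext i
      simp [mul_add, Circle.exp_add]
    rw [h, mul_smul, hw s, hv s]
  smul_mem' := by
    intro c v hv s
    have h : (fun i => Circle.exp (s * (c • v) i) : Torus n) =
        (fun i => Circle.exp (s * c * v i) : Torus n) := by
      funext i
      simp [mul_assoc]
    rw [h]
    exact hv (s * c)

/-- The dimension of the orbit `𝕋ⁿ x ≅ 𝕋ⁿ / 𝕋ⁿₓ`, that is, `dim Lie(𝕋ⁿ) / Lie(𝕋ⁿₓ)`. -/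
noncomputable def orbitDim {n : ℕ} {M : Type*} [MulAction (Torus n) M] (x : M) : ℕ :=
  Module.finrank ℝ ((Fin n → ℝ) ⧸ isotropyLieAlgebra (n := n) x)

/-- A smooth manifold is orientable if it is covered by smooth charts whose transition maps
have positive Jacobian determinant. -/
def IsOrientableManifold (d : ℕ) (M : Type*) [TopologicalSpace M]
    [ChartedSpace (EuclideanSpace ℝ (Fin d)) M] : Prop :=
  ∃ A ⊆ IsManifold.maximalAtlas (𝓡 d) ∞ M,
    (∀ x : M, ∃ e ∈ A, x ∈ e.source) ∧
    ∀ e ∈ A, ∀ e' ∈ A, ∀ z ∈ (e.symm.trans e').source,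
      0 < (fderiv ℝ (e.symm.trans e') z).det

/-- The action of `𝕋ⁿ` on the `2n`-manifold `M` is locally standard: every point has an invariant
open neighbourhood which is diffeomorphic to an invariant open subset of `ℂⁿ`, equivariantly
up to an automorphism `δ` of the torus, for the coordinatewise action of `𝕋ⁿ` on `ℂⁿ`. -/
def IsLocallyStandard (n : ℕ) (M : Type*) [TopologicalSpace M]
    [ChartedSpace (EuclideanSpace ℝ (Fin (2 * n))) M] [MulAction (Torus n) M] : Prop :=
  ∀ y : M, ∃ (ψ : OpenPartialHomeomorph M (Fin n → ℂ)) (δ : Torus n ≃ₜ* Torus n),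
    y ∈ ψ.source ∧
    (∀ t : Torus n, ∀ x ∈ ψ.source, t • x ∈ ψ.source) ∧
    (∀ t : Torus n, ∀ z ∈ ψ.target, (fun i => (t i : ℂ) * z i) ∈ ψ.target) ∧
    ContMDiffOn (𝓡 (2 * n)) 𝓘(ℝ, Fin n → ℂ) ∞ ψ ψ.source ∧
    ContMDiffOn 𝓘(ℝ, Fin n → ℂ) (𝓡 (2 * n)) ∞ ψ.symm ψ.target ∧
    ∀ t : Torus n, ∀ x ∈ ψ.source, ψ (t • x) = fun i => (δ t i : ℂ) * ψ x i

/-- `q` exhibits `P` as the orbit space of the `𝕋ⁿ`-space `M`: it is continuous with image `P`, its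
fibres are exactly the orbits, and it maps every `l`-dimensional orbit to a point in the
relative interior of an `l`-dimensional face of `P`. -/
structure IsOrbitProjection {n : ℕ} {M : Type*} [TopologicalSpace M] [MulAction (Torus n) M]
    (P : Set (EuclideanSpace ℝ (Fin n))) (q : M → EuclideanSpace ℝ (Fin n)) : Prop where
  continuous : Continuous q
  range_eq : Set.range q = P
  eq_iff : ∀ x y : M, q x = q y ↔ x ∈ MulAction.orbit (Torus n) y
  mem_face : ∀ x : M, ∃ F, IsPolytopeFace P F ∧ convexDim F = orbitDim (n := n) x ∧
    q x ∈ intrinsicInterior ℝ F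

/-- A `2n`-dimensional quasitoric manifold: a closed, connected, orientable smooth manifold of
dimension `2n` with a smooth, locally standard action of `𝕋ⁿ` whose orbit space is an
`n`-dimensional simple polytope with nonempty boundary. -/
structure IsQuasitoricManifold (n : ℕ) (M : Type*) [TopologicalSpace M]
    [ChartedSpace (EuclideanSpace ℝ (Fin (2 * n))) M] [MulAction (Torus n) M] : Prop where
  t2Space : T2Space M
  compactSpace : CompactSpace M
  connectedSpace : ConnectedSpace M
  isManifold : IsManifold (𝓡 (2 * n)) ∞ M
  orientable : IsOrientableManifold (2 * n) M
  contMDiff_smul :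
    ContMDiff ((ModelWithCorners.pi fun _ : Fin n => 𝓡 1).prod (𝓡 (2 * n))) (𝓡 (2 * n)) ∞
      (fun p : Torus n × M => p.1 • p.2)
  locallyStandard : IsLocallyStandard n M
  exists_polytope : ∃ P : Set (EuclideanSpace ℝ (Fin n)),
    IsSimplePolytope n P ∧ (frontier P).Nonempty ∧
      ∃ q : M → EuclideanSpace ℝ (Fin n), IsOrbitProjection P q

/-! Lower bound: an equivariant homotopy keeps a fixed point inside the fixed point set. That set is
finite, hence discrete, so the point never moves and is itself the whole target orbit. A categorical
set therefore contains at most one fixed point (`IsGCategorical.eq_of_mem_fixedPoints`), and the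
fixed points of the product are the pairs of fixed points.

Upper bound: it suffices to cover each factor by categorical sets, one around each fixed point
(`IsQuasitoricManifold.exists_cover`). A categorical set with a fixed point contracts onto a fixed
point, so products of such sets are again categorical (`IsGCategorical.prod`).

To build the cover, note that the fixed points lie over the vertices of P, and that P is a union of
compact sets K_v, star-shaped about the vertex v and meeting only faces through v. Pushing a point
of K_v towards v without reaching it keeps it in the same open face. In a standard chart the same
coordinates then vanish, so the push lifts to M by changing moduli and keeping arguments
(`IsOrbitProjection.exists_lift`). Finitely many local pushes compose to one that moves every point
over K_v, except possibly the fixed point over v. Its iterates squeeze K_v into any neighbourhood of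
v, and over a small one a chart contracts linearly to the fixed point. Pulling the chart ball back
along the iterate, which is equivariantly homotopic to the identity, gives a categorical set
containing everything over K_v. -/

open Set Topology unitInterval

/-! ### Faces of polytopes and the star-shaped cover. -/

section Convex

variable {E : Type*} [NormedAddCommGroup E] [NormedSpace ℝ E]

/-- The line from `a` through `p` stays in the affine span, where `A` is a neighbourhood of `p`;
hence it can be prolonged slightly beyond `p` inside `A`. -/
theorem exists_mem_openSegment_of_mem_intrinsicInterior {A : Set E} {a p : E}
    (hp : p ∈ intrinsicInterior ℝ A) (ha : a ∈ A) : ∃ y ∈ A, p ∈ openSegment ℝ a y := by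
  obtain ⟨⟨p', hp'⟩, hint, rfl⟩ := mem_intrinsicInterior.1 hp
  have haS : a ∈ affineSpan ℝ A := subset_affineSpan ℝ A ha
  let g : ℝ → affineSpan ℝ A := fun t =>
    ⟨AffineMap.lineMap a p' t, AffineMap.lineMap_mem t haS hp'⟩
  have hg : Continuous g := by
    refine Continuous.subtype_mk ?_ _
    exact AffineMap.lineMap_continuous
  have h1 : g 1 = ⟨p', hp'⟩ := by
    apply Subtype.ext
    simp [g]
  have hev : ∀ᶠ t in 𝓝 (1 : ℝ), g t ∈ Subtype.val ⁻¹' A := by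
    apply hg.continuousAt
    rw [h1]
    exact mem_interior_iff_mem_nhds.1 hint
  obtain ⟨ε, hε, hball⟩ := Metric.eventually_nhds_iff.1 hev
  have ht : g (1 + ε / 2) ∈ Subtype.val ⁻¹' A := by
    apply hball
    rw [Real.dist_eq]
    rw [abs_of_pos] <;> linarith
  refine ⟨_, ht, (ε / 2) / (1 + ε / 2), 1 / (1 + ε / 2), by positivity, by positivity, ?_, ?_⟩
  · field_simp
    ring
  · have h0 : (1 + ε / 2) ≠ 0 := by positivity
    simp only [g, AffineMap.lineMap_apply_module]
    rw [smul_add, smul_smul, smul_smul, ← add_assoc, ← add_smul]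
    have e1 : ε / 2 / (1 + ε / 2) + 1 / (1 + ε / 2) * (1 - (1 + ε / 2)) = 0 := by
      field_simp
      ring
    have e2 : 1 / (1 + ε / 2) * (1 + ε / 2) = 1 := by field_simp
    rw [e1, e2]
    simp

theorem IsExtreme.subset_of_mem_intrinsicInterior {P A B : Set E} {p : E}
    (hB : IsExtreme ℝ P B) (hAP : A ⊆ P) (hp : p ∈ intrinsicInterior ℝ A) (hpB : p ∈ B) :
    A ⊆ B := by
  intro a ha
  obtain ⟨y, hy, hpy⟩ := exists_mem_openSegment_of_mem_intrinsicInterior hp ha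
  exact hB.2 (hAP ha) (hAP hy) hpB hpy

/-- Relative interiors of distinct faces are disjoint, so the face supplied by `mem_face` depends
only on the image in the orbit space. -/
theorem IsPolytopeFace.eq_of_mem_intrinsicInterior {P F F' : Set E} {p : E}
    (hF : IsPolytopeFace P F) (hF' : IsPolytopeFace P F')
    (hp : p ∈ intrinsicInterior ℝ F) (hp' : p ∈ intrinsicInterior ℝ F') : F = F' :=
  Subset.antisymm
    (hF'.2.isExtreme.subset_of_mem_intrinsicInterior hF.2.subset hp (intrinsicInterior_subset hp'))
    (hF.2.isExtreme.subset_of_mem_intrinsicInterior hF'.2.subset hp' (intrinsicInterior_subset hp))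

/-- Moving from a relative interior point of a face towards a point of that face, without
reaching it, one stays in the relative interior of the same face. -/
theorem IsPolytopeFace.eq_of_mem_openSegment {P F F' : Set E} {p v p' : E} (hP : Convex ℝ P)
    (hF : IsPolytopeFace P F) (hF' : IsPolytopeFace P F')
    (hp : p ∈ intrinsicInterior ℝ F) (hv : v ∈ F) (hpp' : p' ∈ openSegment ℝ p v)
    (hp' : p' ∈ intrinsicInterior ℝ F') : F = F' := by
  have hpF : p ∈ F := intrinsicInterior_subset hp
  refine Subset.antisymm ?_ ?_
  · refine hF'.2.isExtreme.subset_of_mem_intrinsicInterior hF.2.subset hp ?_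
    exact hF'.2.isExtreme.2 (hF.2.subset hpF) (hF.2.subset hv) (intrinsicInterior_subset hp') hpp'
  · refine hF.2.isExtreme.subset_of_mem_intrinsicInterior hF'.2.subset hp' ?_
    exact (hF.2.convex hP).openSegment_subset hpF hv hpp'

theorem convexDim_singleton (v : E) : convexDim ({v} : Set E) = 0 := by
  simp [convexDim]

theorem IsPolytopeFace.eq_singleton_of_convexDim_eq_zero [FiniteDimensional ℝ E] {P F : Set E}
    (hF : IsPolytopeFace P F) (h : convexDim F = 0) : ∃ v ∈ P.extremePoints ℝ, F = {v} := by
  obtain ⟨v, hv⟩ := hF.1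
  have hFv : F = {v} := by
    refine Subset.antisymm (fun w hw => ?_) (singleton_subset_iff.2 hv)
    have hbot : vectorSpan ℝ F = ⊥ := Submodule.finrank_eq_zero.1 h
    have := vsub_mem_vectorSpan ℝ hw hv
    rw [hbot, Submodule.mem_bot, vsub_eq_sub, sub_eq_zero] at this
    exact this
  refine ⟨v, ?_, hFv⟩
  have := hF.2.isExtreme
  rw [hFv] at this
  exact isExtreme_singleton.1 this

theorem IsPolytopeFace.eq_singleton_of_mem_extremePoints {P F : Set E} {v : E}
    (hF : IsPolytopeFace P F) (hv : v ∈ P.extremePoints ℝ) (hvF : v ∈ intrinsicInterior ℝ F) :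
    F = {v} :=
  Subset.antisymm
    ((isExtreme_singleton.2 hv).subset_of_mem_intrinsicInterior hF.2.subset hvF rfl)
    (singleton_subset_iff.2 (intrinsicInterior_subset hvF))

/-- By Krein–Milman a face is recovered from the vertices of `P` that it contains. -/
theorem finite_setOf_isPolytopeFace {P : Set E} (hP : IsCompact P) (hc : Convex ℝ P)
    (hfin : (P.extremePoints ℝ).Finite) : {F | IsPolytopeFace P F}.Finite := by
  refine Set.Finite.of_finite_image (f := fun F => F ∩ P.extremePoints ℝ)
    (hfin.finite_subsets.subset ?_) ?_
  · rintro _ ⟨F, -, rfl⟩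
    exact inter_subset_right
  · intro F hF F' hF' h
    have key : ∀ G, IsPolytopeFace P G → closure (convexHull ℝ (G ∩ P.extremePoints ℝ)) = G := by
      intro G hG
      rw [← hG.2.isExtreme.extremePoints_eq]
      exact closure_convexHull_extremePoints (hG.2.isCompact hP) (hG.2.convex hc)
    rw [← key F hF, ← key F' hF']
    exact congrArg (fun A => closure (convexHull ℝ A)) h

/-- A polytope is covered by compact sets, one for each vertex, that are star-shaped about the
vertex and meet only those faces that contain the vertex. -/
theorem exists_isCompact_star_cover {V : Set E} (hV : V.Finite) :
    ∃ K : E → Set E, (∀ v ∈ V, IsCompact (K v) ∧ K v ⊆ convexHull ℝ V ∧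
      v ∈ K v ∧ (∀ p ∈ K v, ∀ s ∈ Icc (0 : ℝ) 1, p + s • (v - p) ∈ K v) ∧
      ∀ F p, IsPolytopeFace (convexHull ℝ V) F → p ∈ F → p ∈ K v → v ∈ F) ∧
      ∀ p ∈ convexHull ℝ V, ∃ v ∈ V, p ∈ K v := by
  classical
  lift V to Finset E using hV
  -- Some barycentric weight is at least 1/card, which exceeds `c`. The extra 1 keeps `c` below 1
  -- even for a single vertex, so that division by `1 - c` is allowed.
  set c : ℝ := 1 / ((V.card : ℝ) + 1) with hc
  have hc0 : 0 < c := by positivity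
  have hPc := convex_convexHull ℝ (V : Set E)
  refine ⟨fun v => (fun z : ℝ × E => z.1 • v + (1 - z.1) • z.2) ''
    (Icc c 1 ×ˢ convexHull ℝ (V : Set E)), fun v hv => ⟨?_, ?_, ?_, ?_, ?_⟩, ?_⟩
  · refine (isCompact_Icc.prod (V.finite_toSet.isCompact_convexHull ℝ)).image ?_
    fun_prop
  · rintro _ ⟨⟨d, y⟩, ⟨⟨hd, hd1⟩, hy⟩, rfl⟩
    exact hPc (subset_convexHull ℝ _ hv) hy (hc0.le.trans hd) (sub_nonneg.2 hd1) (by ring)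
  · refine ⟨⟨1, v⟩, ⟨⟨?_, le_rfl⟩, subset_convexHull ℝ _ hv⟩, by simp⟩
    rw [hc, div_le_one (by positivity)]
    linarith [(Nat.cast_nonneg V.card : (0 : ℝ) ≤ V.card)]
  · rintro _ ⟨⟨d, y⟩, ⟨⟨hd, hd1⟩, hy⟩, rfl⟩ s ⟨hs0, hs1⟩
    simp only at hd hd1 hy
    refine ⟨⟨d + s * (1 - d), y⟩, ⟨⟨?_, ?_⟩, hy⟩, ?_⟩
    · change c ≤ d + s * (1 - d)
      nlinarith
    · change d + s * (1 - d) ≤ 1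
      nlinarith
    · simp only
      module
  · rintro F _ hF hpF ⟨⟨d, y⟩, ⟨⟨hd, hd1⟩, hy⟩, rfl⟩
    simp only at hd hd1 hy hpF
    rcases hd1.eq_or_lt with rfl | hd1
    · simpa using hpF
    · exact hF.2.isExtreme.2 (subset_convexHull ℝ _ hv) hy hpF
        ⟨d, 1 - d, hc0.trans_le hd, sub_pos.2 hd1, by ring, rfl⟩
  · intro p hp
    obtain ⟨w, hw0, hw1, hwp⟩ := Finset.mem_convexHull'.1 hp
    have hne : V.Nonempty := by
      rw [Finset.nonempty_iff_ne_empty]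
      rintro rfl
      simp at hw1
    have hcard : (1 : ℝ) ≤ V.card := by exact_mod_cast hne.card_pos
    have hc1 : c < 1 := by
      rw [hc, div_lt_one (by positivity)]
      linarith
    obtain ⟨v, hv, hwv⟩ : ∃ v ∈ V, c ≤ w v := by
      refine Finset.exists_le_of_sum_le hne ?_
      rw [hw1, Finset.sum_const, nsmul_eq_mul, hc, mul_one_div, div_le_one (by positivity)]
      linarith
    -- Remove the weight `c` from `v` and renormalise the rest.
    refine ⟨v, hv, ⟨c, ∑ u ∈ V, ((w u - if u = v then c else 0) / (1 - c)) • u⟩,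
      ⟨⟨le_rfl, hc1.le⟩, ?_⟩, ?_⟩
    · refine hPc.sum_mem (fun u hu => ?_) ?_ fun u hu => subset_convexHull ℝ _ hu
      · refine div_nonneg ?_ (sub_nonneg.2 hc1.le)
        split_ifs with h
        · rw [h]
          linarith
        · simpa using hw0 u hu
      · rw [← Finset.sum_div, Finset.sum_sub_distrib, hw1, Finset.sum_ite_eq' V v, if_pos hv]
        exact div_self (sub_pos.2 hc1).ne'
    · have hcne : (1 - c) ≠ 0 := (sub_pos.2 hc1).ne'
      simp only [Finset.smul_sum, smul_smul, mul_div_cancel₀ _ hcne, sub_smul,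
        Finset.sum_sub_distrib, hwp, ite_smul, zero_smul, Finset.sum_ite_eq' V v, if_pos hv]
      abel

end Convex

/-! ### Isotropy and orbit dimension in standard charts. -/

section Torus

/-- A continuous one-parameter subgroup of the circle is `s ↦ exp (i s a)`. -/
theorem Circle.exists_eq_exp_mul_of_continuous {f : ℝ → Circle} (hf : Continuous f)
    (hmul : ∀ s t, f (s + t) = f s * f t) : ∃ a : ℝ, ∀ s, f s = Circle.exp (s * a) := by
  have h0 : f 0 = 1 := by simpa using hmul 0 0
  -- The lift of `f` through the covering `Circle.exp` is additive by uniqueness of lifts, hence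
  -- linear by continuity.
  obtain ⟨g, ⟨hg0, hg⟩, -⟩ := Circle.isCoveringMap_exp.existsUnique_continuousMap_lifts
    (⟨f, hf⟩ : C(ℝ, Circle)) 0 0 (by simp [h0])
  have hgf : ∀ s, Circle.exp (g s) = f s := fun s => congrFun hg s
  have hadd : ∀ s t, g (s + t) = g s + g t := by
    intro s t
    have : (fun s => g (s + t)) = fun s => g s + g t := by
      refine Circle.isCoveringMap_exp.eq_of_comp_eq (by fun_prop) (by fun_prop) ?_ 0
        (by simp [hg0])
      funext s
      simp [Circle.exp_add, hgf, hmul]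
    exact congrFun this s
  let L : ℝ →L[ℝ] ℝ := (AddMonoidHom.mk' g hadd).toRealLinearMap g.continuous
  refine ⟨g 1, fun s => ?_⟩
  have : L s = s * L 1 := by
    rw [← smul_eq_mul, ← map_smul, smul_eq_mul, mul_one]
  rw [← hgf]
  exact congrArg Circle.exp this

variable {n : ℕ} {M : Type*} [MulAction (Torus n) M]

theorem mem_isotropyLieAlgebra {x : M} {v : Fin n → ℝ} :
    v ∈ isotropyLieAlgebra (n := n) x ↔
      ∀ s : ℝ, (fun i => Circle.exp (s * v i) : Torus n) • x = x :=
  Iff.rfl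

/-- Every torus element lies on a one-parameter subgroup, through its arguments, so a full isotropy
Lie algebra means a fixed point. -/
theorem orbitDim_eq_zero_iff {x : M} :
    orbitDim (n := n) x = 0 ↔ x ∈ MulAction.fixedPoints (Torus n) M := by
  rw [orbitDim, Module.finrank_zero_iff, Submodule.Quotient.subsingleton_iff]
  refine ⟨fun h t => ?_, fun h => ?_⟩
  · have ht : (fun i => ((t i : ℂ)).arg) ∈ isotropyLieAlgebra (n := n) x := by
      rw [h]
      trivial
    simpa using mem_isotropyLieAlgebra.1 ht 1
  · rw [eq_top_iff]
    exact fun _ _ _ => h _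

theorem isotropyLieAlgebra_eq_of_le {x y : M} (h : orbitDim (n := n) x = orbitDim (n := n) y)
    (hle : isotropyLieAlgebra (n := n) x ≤ isotropyLieAlgebra (n := n) y) :
    isotropyLieAlgebra (n := n) x = isotropyLieAlgebra (n := n) y := by
  refine Submodule.eq_of_le_of_finrank_eq hle ?_
  have hx := (isotropyLieAlgebra (n := n) x).finrank_quotient_add_finrank
  have hy := (isotropyLieAlgebra (n := n) y).finrank_quotient_add_finrank
  rw [orbitDim, orbitDim] at h
  omega

variable [TopologicalSpace M]

/-- A chart onto an invariant open subset of `ℂⁿ` in which the torus acts coordinatewise, up to the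
automorphism `δ` of the torus. -/
structure IsStandardChart (ψ : OpenPartialHomeomorph M (Fin n → ℂ)) (δ : Torus n ≃ₜ* Torus n) :
    Prop where
  smul_mem_source : ∀ t : Torus n, ∀ x ∈ ψ.source, t • x ∈ ψ.source
  map_smul : ∀ t : Torus n, ∀ x ∈ ψ.source, ψ (t • x) = fun i => (δ t i : ℂ) * ψ x i

namespace IsStandardChart

variable {ψ : OpenPartialHomeomorph M (Fin n → ℂ)} {δ : Torus n ≃ₜ* Torus n}

theorem smul_eq_self_iff (h : IsStandardChart ψ δ) {x : M} (hx : x ∈ ψ.source) (t : Torus n) :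
    t • x = x ↔ ∀ i, ψ x i ≠ 0 → δ t i = 1 := by
  rw [← ψ.injOn.eq_iff (h.smul_mem_source t x hx) hx, h.map_smul t x hx, funext_iff]
  refine forall_congr' fun i => ?_
  by_cases hi : ψ x i = 0
  · simp [hi]
  · rw [mul_eq_right₀ hi, Circle.coe_eq_one]
    simp [hi]

theorem isotropyLieAlgebra_le (h : IsStandardChart ψ δ) {x y : M} (hx : x ∈ ψ.source)
    (hy : y ∈ ψ.source) (hxy : ∀ i, ψ x i ≠ 0 → ψ y i ≠ 0) :
    isotropyLieAlgebra (n := n) y ≤ isotropyLieAlgebra (n := n) x := fun _ hv s =>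
  (h.smul_eq_self_iff hx _).2 fun i hi => (h.smul_eq_self_iff hy _).1 (hv s) i (hxy i hi)

/-- In a standard chart, the dimension of the orbit of a point determines how many of its
coordinates vanish. -/
theorem ne_zero_of_orbitDim_eq (h : IsStandardChart ψ δ) {x y : M} (hx : x ∈ ψ.source)
    (hy : y ∈ ψ.source) (hxy : ∀ i, ψ x i ≠ 0 → ψ y i ≠ 0)
    (hdim : orbitDim (n := n) x = orbitDim (n := n) y) {i : Fin n} (hi : ψ y i ≠ 0) :
    ψ x i ≠ 0 := by
  intro hxi
  have heq := isotropyLieAlgebra_eq_of_le hdim.symm (h.isotropyLieAlgebra_le hx hy hxy)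
  -- The preimage under `δ` of the `i`-th circle is a one-parameter subgroup. Its direction `a` lies
  -- in the isotropy algebra of `x`, where coordinate `i` vanishes, but not in that of `y`: at
  -- parameter π it acts on coordinate `i` by -1.
  have hγ : ∀ j, ∃ a : ℝ, ∀ s : ℝ,
      δ.symm (Pi.mulSingle i (Circle.exp s)) j = Circle.exp (s * a) := by
    intro j
    refine Circle.exists_eq_exp_mul_of_continuous (f := fun s =>
      δ.symm (Pi.mulSingle i (Circle.exp s)) j) ?_ fun s t => ?_
    · have h1 : Continuous fun s : ℝ => (Pi.mulSingle i (Circle.exp s) : Torus n) :=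
        (continuous_mulSingle i).comp Circle.exp.continuous
      have h2 : Continuous fun s : ℝ => δ.symm (Pi.mulSingle i (Circle.exp s) : Torus n) :=
        δ.symm.continuous.comp h1
      exact (continuous_apply j).comp h2
    · rw [Circle.exp_add, Pi.mulSingle_mul, map_mul, Pi.mul_apply]
  choose a ha using hγ
  have hδ : ∀ s : ℝ, δ (fun j => Circle.exp (s * a j)) = Pi.mulSingle i (Circle.exp s) := by
    intro s
    rw [← δ.apply_symm_apply (Pi.mulSingle i (Circle.exp s))]
    congr 1
    funext j
    exact (ha j s).symm
  have hmem : a ∈ isotropyLieAlgebra (n := n) x := fun s =>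
    (h.smul_eq_self_iff hx _).2 fun j hj => by
      have hji : j ≠ i := by
        rintro rfl
        exact hj hxi
      rw [hδ, Pi.mulSingle_eq_of_ne hji]
  rw [← heq] at hmem
  have h1 := (h.smul_eq_self_iff hy _).1 (hmem Real.pi) i hi
  rw [hδ, Pi.mulSingle_eq_same, Circle.ext_iff] at h1
  norm_num [Complex.exp_pi_mul_I] at h1

theorem apply_eq_zero_of_mem_fixedPoints (h : IsStandardChart ψ δ) {x : M} (hx : x ∈ ψ.source)
    (hfix : x ∈ MulAction.fixedPoints (Torus n) M) : ψ x = 0 := by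
  funext i
  by_contra hi
  have := (h.smul_eq_self_iff hx (δ.symm fun _ => Circle.exp Real.pi)).1 (hfix _) i hi
  rw [δ.apply_symm_apply, Circle.ext_iff] at this
  norm_num [Complex.exp_pi_mul_I] at this

end IsStandardChart

end Torus

/-! ### The orbit projection and the moduli on the orbit space. -/

namespace IsOrbitProjection

variable {n : ℕ} {M : Type*} [TopologicalSpace M] [MulAction (Torus n) M]
  {P : Set (EuclideanSpace ℝ (Fin n))} {q : M → EuclideanSpace ℝ (Fin n)}

theorem map_smul (hq : IsOrbitProjection P q) (t : Torus n) (x : M) : q (t • x) = q x :=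
  (hq.eq_iff _ _).2 ⟨t, rfl⟩

/-- A tube lemma: `q` is a closed map because `M` is compact. -/
theorem eventually_mem [CompactSpace M] (hq : IsOrbitProjection P q)
    {p : EuclideanSpace ℝ (Fin n)} {O : Set M} (hO : IsOpen O) (hp : ∀ x, q x = p → x ∈ O) :
    ∀ᶠ p' in 𝓝 p, ∀ x, q x = p' → x ∈ O := by
  have hclosed : IsClosed (q '' Oᶜ) := hq.continuous.isClosedMap _ hO.isClosed_compl
  have hmem : p ∈ (q '' Oᶜ)ᶜ := by
    rintro ⟨x, hx, rfl⟩
    exact hx (hp x rfl)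
  filter_upwards [hclosed.isOpen_compl.mem_nhds hmem] with p' hp' x hx
  by_contra hxO
  exact hp' ⟨x, hxO, hx⟩

/-- For `s < 1` the point stays in the relative interior of the same face, whose dimension is the
orbit dimension. -/
theorem orbitDim_eq_of_eq_add_smul (hq : IsOrbitProjection P q) (hP : Convex ℝ P)
    {v : EuclideanSpace ℝ (Fin n)} {x y : M}
    (hv : ∀ F, IsPolytopeFace P F → q x ∈ F → v ∈ F) {s : ℝ} (hs : s ∈ Ico (0 : ℝ) 1)
    (hxy : q y = q x + s • (v - q x)) : orbitDim (n := n) x = orbitDim (n := n) y := by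
  obtain ⟨F, hF, hFd, hFx⟩ := hq.mem_face x
  obtain ⟨F', hF', hFd', hFy⟩ := hq.mem_face y
  rw [← hFd, ← hFd']
  congr 1
  rcases hs.1.eq_or_lt with rfl | hs0
  · rw [zero_smul, add_zero] at hxy
    exact hF.eq_of_mem_intrinsicInterior hF' hFx (hxy ▸ hFy)
  · refine hF.eq_of_mem_openSegment hP hF' hFx (hv F hF (intrinsicInterior_subset hFx)) ?_ hFy
    refine ⟨1 - s, s, sub_pos.2 hs.2, hs0, by ring, ?_⟩
    rw [hxy]
    module

variable {ψ : OpenPartialHomeomorph M (Fin n → ℂ)} {δ : Torus n ≃ₜ* Torus n}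

/-- The moduli of the coordinates in a standard chart descend to continuous functions on the
image of the chart domain in the orbit space. -/
theorem exists_radius [CompactSpace M] (hq : IsOrbitProjection P q) (h : IsStandardChart ψ δ) :
    ∃ ρ : EuclideanSpace ℝ (Fin n) → Fin n → ℝ, ContinuousOn ρ (q '' ψ.source) ∧
      ∀ x ∈ ψ.source, ∀ i, ρ (q x) i = ‖ψ x i‖ := by
  classical
  have hinv : ∀ x ∈ ψ.source, ∀ y, q y = q x → y ∈ ψ.source ∧ ∀ i, ‖ψ y i‖ = ‖ψ x i‖ := by
    intro x hx y hyx
    obtain ⟨t, rfl⟩ := (hq.eq_iff _ _).1 hyx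
    refine ⟨h.smul_mem_source t x hx, fun i => ?_⟩
    change ‖ψ (t • x) i‖ = _
    rw [h.map_smul t x hx, norm_mul, Circle.norm_coe, one_mul]
  let ρ : EuclideanSpace ℝ (Fin n) → Fin n → ℝ := fun p i =>
    if hp : ∃ x, q x = p then ‖ψ hp.choose i‖ else 0
  have hρ : ∀ x ∈ ψ.source, ∀ i, ρ (q x) i = ‖ψ x i‖ := by
    intro x hx i
    have hp : ∃ y, q y = q x := ⟨x, rfl⟩
    simp only [ρ, dif_pos hp]
    exact (hinv x hx _ hp.choose_spec).2 i
  refine ⟨ρ, ?_, hρ⟩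
  rintro _ ⟨x, hx, rfl⟩
  refine tendsto_nhds.2 fun N hN hxN => ?_
  have hcont : ContinuousOn (fun y i => ‖ψ y i‖) ψ.source :=
    continuousOn_pi.2 fun i => (continuousOn_pi.1 ψ.continuousOn i).norm
  have hO := hcont.isOpen_inter_preimage ψ.open_source hN
  have hρx : ∀ y ∈ ψ.source, ρ (q y) = fun i => ‖ψ y i‖ := fun y hy => funext (hρ y hy)
  have hev := hq.eventually_mem (p := q x) hO fun y hy => by
    obtain ⟨hys, -⟩ := hinv x hx y hy
    refine ⟨hys, ?_⟩
    rw [mem_preimage, ← hρx y hys, hy]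
    exact hxN
  filter_upwards [nhdsWithin_le_nhds hev, self_mem_nhdsWithin]
  rintro _ hp ⟨y, hy, rfl⟩
  rw [mem_preimage, hρx y hy]
  exact (hp y rfl).2

end IsOrbitProjection

theorem Circle.exists_mul_eq_of_norm_eq {a b : ℂ} (h : ‖a‖ = ‖b‖) : ∃ u : Circle, a = u * b := by
  by_cases hb : b = 0
  · refine ⟨1, ?_⟩
    rw [hb, norm_zero, norm_eq_zero] at h
    simp [h, hb]
  · refine ⟨⟨a / b, ?_⟩, ?_⟩
    · change a / b ∈ Metric.sphere (0 : ℂ) 1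
      rw [mem_sphere_zero_iff_norm, norm_div, h, div_self (norm_ne_zero_iff.2 hb)]
    · exact (div_mul_cancel₀ a hb).symm

/-! ### Lifting homotopies of the orbit space. -/

section Lift

variable {n : ℕ} {M : Type*} [TopologicalSpace M] [MulAction (Torus n) M]
  {P : Set (EuclideanSpace ℝ (Fin n))} {q : M → EuclideanSpace ℝ (Fin n)}
  {ψ : OpenPartialHomeomorph M (Fin n → ℂ)} {δ : Torus n ≃ₜ* Torus n}

theorem IsStandardChart.exists_eq_of_norm_eq (h : IsStandardChart ψ δ) {x : M}
    (hx : x ∈ ψ.source) {z : Fin n → ℂ} (hz : ∀ i, ‖z i‖ = ‖ψ x i‖) :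
    ∃ t : Torus n, ψ (t • x) = z := by
  choose u hu using fun i => Circle.exists_mul_eq_of_norm_eq (hz i)
  refine ⟨δ.symm u, ?_⟩
  rw [h.map_smul _ x hx, δ.apply_symm_apply]
  exact (funext hu).symm

/-- The zero set of the coordinates does not change on a segment which stays in the
relative interior of one face. -/
theorem IsStandardChart.apply_eq_zero_of_path (h : IsStandardChart ψ δ)
    {ρ : EuclideanSpace ℝ (Fin n) → Fin n → ℝ} (hρc : ContinuousOn ρ (q '' ψ.source))
    (hρ : ∀ x ∈ ψ.source, ∀ i, ρ (q x) i = ‖ψ x i‖) {m : I → M} (hm : ∀ s, m s ∈ ψ.source)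
    (hmc : Continuous fun s => q (m s))
    (hdim : ∀ s, orbitDim (n := n) (m s) = orbitDim (n := n) (m 0)) {i : Fin n}
    (hi : ψ (m 0) i = 0) (s : I) : ψ (m s) i = 0 := by
  have hcont : Continuous fun s => ρ (q (m s)) :=
    hρc.comp_continuous hmc fun s => ⟨_, hm s, rfl⟩
  have hne : ∀ s i, ψ (m s) i ≠ 0 ↔ ρ (q (m s)) i ≠ 0 := fun s i => by
    rw [hρ _ (hm s), norm_ne_zero_iff]
  -- Nonvanishing is an open condition, so the set of nonzero coordinates can locally only grow;
  -- constancy of the orbit dimension forbids growth.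
  have hlc : IsLocallyConstant fun s => {i | ψ (m s) i ≠ 0} := by
    refine (IsLocallyConstant.iff_eventually_eq _).2 fun s => ?_
    have hev : ∀ᶠ s' in 𝓝 s, ∀ i, ψ (m s) i ≠ 0 → ψ (m s') i ≠ 0 := by
      refine Filter.eventually_all.2 fun i => ?_
      by_cases hsi : ψ (m s) i = 0
      · exact Filter.Eventually.of_forall fun _ hn => absurd hsi hn
      · have := ((continuous_apply i).comp hcont).continuousAt.eventually_ne ((hne s i).1 hsi)
        filter_upwards [this] with s' hs' _
        exact (hne s' i).2 hs'
    filter_upwards [hev] with s' hs'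
    ext i
    exact ⟨h.ne_zero_of_orbitDim_eq (hm s) (hm s') hs' ((hdim s).trans (hdim s').symm), hs' i⟩
  have := hlc.apply_eq_of_preconnectedSpace s 0
  by_contra hsi
  have hmem : i ∈ {i | ψ (m s) i ≠ 0} := hsi
  rw [this] at hmem
  exact hmem hi

/-- The point of `ℂⁿ` with the arguments of `z` and the moduli `r`. -/
noncomputable def rescaleModuli (r : Fin n → ℝ) (z : Fin n → ℂ) : Fin n → ℂ := fun i =>
  ((r i / ‖z i‖ : ℝ) : ℂ) * z i

theorem norm_rescaleModuli {r : Fin n → ℝ} {z : Fin n → ℂ} (hr : ∀ i, 0 ≤ r i)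
    (hz : ∀ i, z i = 0 → r i = 0) (i : Fin n) : ‖rescaleModuli r z i‖ = r i := by
  by_cases hi : z i = 0
  · simp [rescaleModuli, hi, hz i hi]
  · rw [rescaleModuli, norm_mul, Complex.norm_real, norm_div, norm_norm,
      div_mul_cancel₀ _ (norm_ne_zero_iff.2 hi), Real.norm_of_nonneg (hr i)]

theorem rescaleModuli_norm (z : Fin n → ℂ) : rescaleModuli (fun i => ‖z i‖) z = z := by
  funext i
  by_cases hi : z i = 0
  · simp [rescaleModuli, hi]
  · simp [rescaleModuli, div_self (norm_ne_zero_iff.2 hi)]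

theorem rescaleModuli_smul (r : Fin n → ℝ) (z : Fin n → ℂ) (u : Torus n) :
    rescaleModuli r (fun i => (u i : ℂ) * z i) = fun i => (u i : ℂ) * rescaleModuli r z i := by
  funext i
  simp only [rescaleModuli, norm_mul, Circle.norm_coe, one_mul]
  ring

/-- Arguments are discontinuous where a coordinate of `z` vanishes, but there the new modulus `r`
tends to 0. -/
theorem ContinuousOn.rescaleModuli {X : Type*} [TopologicalSpace X] {A : Set X}
    {r : X → Fin n → ℝ} {z : X → Fin n → ℂ} (hr : ContinuousOn r A) (hz : ContinuousOn z A)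
    (hr0 : ∀ x ∈ A, ∀ i, 0 ≤ r x i) (hrz : ∀ x ∈ A, ∀ i, z x i = 0 → r x i = 0) :
    ContinuousOn (fun x => rescaleModuli (r x) (z x)) A := by
  refine continuousOn_pi.2 fun i x hx => ?_
  have hri : ContinuousWithinAt (fun x => r x i) A x := continuousOn_pi.1 hr i x hx
  have hzi : ContinuousWithinAt (fun x => z x i) A x := continuousOn_pi.1 hz i x hx
  by_cases hi : z x i = 0
  · have h0 : _root_.rescaleModuli (r x) (z x) i = 0 := by simp [_root_.rescaleModuli, hi]
    rw [ContinuousWithinAt, h0, tendsto_zero_iff_norm_tendsto_zero]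
    rw [ContinuousWithinAt, hrz x hx i hi] at hri
    refine hri.congr' ?_
    filter_upwards [self_mem_nhdsWithin] with y hy
    exact (norm_rescaleModuli (hr0 y hy) (hrz y hy) i).symm
  · exact (Complex.continuous_ofReal.continuousAt.comp_continuousWithinAt
      (hri.div hzi.norm (norm_ne_zero_iff.2 hi))).mul hzi

/-- A homotopy of the orbit space that is supported in the image of a standard chart and does not
leave the closed strata lifts to an equivariant homotopy. -/
theorem IsOrbitProjection.exists_lift (hq : IsOrbitProjection P q) (h : IsStandardChart ψ δ)
    {ρ : EuclideanSpace ℝ (Fin n) → Fin n → ℝ} (hρc : ContinuousOn ρ (q '' ψ.source))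
    (hρ : ∀ x ∈ ψ.source, ∀ i, ρ (q x) i = ‖ψ x i‖)
    {m : I × M → EuclideanSpace ℝ (Fin n)} (hm : Continuous m)
    (hmsmul : ∀ s (t : Torus n) x, m (s, t • x) = m (s, x)) (hm0 : ∀ x, m (0, x) = q x)
    (hmsource : ∀ s, ∀ x ∈ ψ.source, m (s, x) ∈ q '' ψ.source)
    (hmzero : ∀ s, ∀ x ∈ ψ.source, ∀ i, ψ x i = 0 → ρ (m (s, x)) i = 0)
    {A : Set M} (hA : IsClosed A) (hAψ : A ⊆ ψ.source) (hmA : ∀ s, ∀ x ∉ A, m (s, x) = q x) :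
    ∃ Φ : C(I × M, M), (∀ x, Φ (0, x) = x) ∧ (∀ s x, q (Φ (s, x)) = m (s, x)) ∧
      ∀ s (t : Torus n) x, Φ (s, t • x) = t • Φ (s, x) := by
  classical
  let Z : I × M → Fin n → ℂ := fun z => rescaleModuli (ρ (m z)) (ψ z.2)
  let Φ : I × M → M := fun z => if z.2 ∈ ψ.source then ψ.symm (Z z) else z.2
  -- A chart point over `m (s, x)` has the moduli of `Z (s, x)`, so some torus translate of it has
  -- exactly these coordinates; thus `Z` stays in the chart's target.
  have hZ : ∀ s, ∀ x ∈ ψ.source, ∃ w ∈ ψ.source, ψ w = Z (s, x) ∧ q w = m (s, x) := by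
    intro s x hx
    obtain ⟨y, hy, hym⟩ := hmsource s x hx
    have hr0 : ∀ i, 0 ≤ ρ (m (s, x)) i := fun i => by
      rw [← hym, hρ y hy]
      exact norm_nonneg _
    obtain ⟨t, ht⟩ := h.exists_eq_of_norm_eq hy (z := Z (s, x)) fun i => by
      rw [← hρ y hy, hym]
      exact norm_rescaleModuli hr0 (hmzero s x hx) i
    exact ⟨t • y, h.smul_mem_source t y hy, ht, by rw [hq.map_smul, hym]⟩
  -- Hence `Φ` is the projection on the open set `Aᶜ`, which together with the chart domain covers
  -- `M`.
  have hfix : ∀ s x, m (s, x) = q x → Φ (s, x) = x := by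
    intro s x hsx
    by_cases hx : x ∈ ψ.source
    · have : Z (s, x) = ψ x := by
        simp only [Z, hsx]
        rw [show ρ (q x) = fun i => ‖ψ x i‖ from funext (hρ x hx), rescaleModuli_norm]
      simp only [Φ, if_pos hx, this, ψ.left_inv hx]
    · simp only [Φ, if_neg hx]
  have hZc : ContinuousOn Z (univ ×ˢ ψ.source) := by
    refine ContinuousOn.rescaleModuli
      (hρc.comp hm.continuousOn fun z hz => hmsource z.1 z.2 hz.2)
      (ψ.continuousOn.comp continuous_snd.continuousOn fun z hz => hz.2) ?_
      fun z hz => hmzero z.1 z.2 hz.2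
    intro z hz i
    obtain ⟨y, hy, hym⟩ := hmsource z.1 z.2 hz.2
    rw [← show q y = m z from hym, hρ y hy]
    exact norm_nonneg _
  have hΦc : Continuous Φ := by
    refine continuous_iff_continuousAt.2 fun z => ?_
    by_cases hz : z.2 ∈ ψ.source
    · have hnhds : univ ×ˢ ψ.source ∈ 𝓝 z :=
        (isOpen_univ.prod ψ.open_source).mem_nhds ⟨trivial, hz⟩
      have hc : ContinuousOn (fun z => ψ.symm (Z z)) (univ ×ˢ ψ.source) :=
        ψ.continuousOn_symm.comp hZc fun z hz => by
          obtain ⟨w, hw, hwZ, -⟩ := hZ z.1 z.2 hz.2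
          rw [← show ψ w = Z z from hwZ]
          exact ψ.map_source hw
      refine (hc.continuousAt hnhds).congr ?_
      filter_upwards [hnhds] with y hy
      exact (if_pos hy.2).symm
    · have hnhds : univ ×ˢ Aᶜ ∈ 𝓝 z :=
        (isOpen_univ.prod hA.isOpen_compl).mem_nhds ⟨trivial, fun hzA => hz (hAψ hzA)⟩
      refine continuous_snd.continuousAt.congr ?_
      filter_upwards [hnhds] with y hy
      exact (hfix y.1 y.2 (hmA _ _ hy.2)).symm
  refine ⟨⟨Φ, hΦc⟩, fun x => hfix 0 x (hm0 x), fun s x => ?_, fun s t x => ?_⟩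
  · change q (Φ (s, x)) = _
    by_cases hx : x ∈ ψ.source
    · obtain ⟨w, hw, hwZ, hwq⟩ := hZ s x hx
      simp only [Φ, if_pos hx]
      rw [← hwZ, ψ.left_inv hw, hwq]
    · rw [hfix s x (hmA s x fun hxA => hx (hAψ hxA)), hmA s x fun hxA => hx (hAψ hxA)]
  · change Φ (s, t • x) = t • Φ (s, x)
    by_cases hx : x ∈ ψ.source
    · obtain ⟨w, hw, hwZ, hwq⟩ := hZ s x hx
      have hZt : Z (s, t • x) = ψ (t • w) := by
        simp only [Z, hmsmul]
        rw [h.map_smul t x hx, rescaleModuli_smul, h.map_smul t w hw, hwZ]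
      simp only [Φ, if_pos hx, if_pos (h.smul_mem_source t x hx), hZt]
      rw [ψ.left_inv (h.smul_mem_source t w hw), ← hwZ, ψ.left_inv hw]
    · have hx' : x ∉ A := fun hxA => hx (hAψ hxA)
      have htx : t • x ∉ ψ.source := fun htx => hx (by simpa using h.smul_mem_source t⁻¹ _ htx)
      simp only [Φ, if_neg hx, if_neg htx]

end Lift

/-! ### Categorical sets: products, preimages and the lower bound. -/

section Equivariant

variable (G : Type*) [Group G] {X : Type*} [TopologicalSpace X] [MulAction G X]

/-- `f` is equivariantly homotopic to the identity. -/
def IsEquivariantlyHomotopicId (f : C(X, X)) : Prop :=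
  (ContinuousMap.id X).HomotopicWith f fun g => ∀ (t : G) x, g (t • x) = t • g x

variable {G}

theorem IsEquivariantlyHomotopicId.refl : IsEquivariantlyHomotopicId G (ContinuousMap.id X) :=
  ContinuousMap.HomotopicWith.refl _ fun _ _ => rfl

theorem IsEquivariantlyHomotopicId.map_smul {f : C(X, X)} (hf : IsEquivariantlyHomotopicId G f)
    (t : G) (x : X) : f (t • x) = t • f x := by
  obtain ⟨F⟩ := hf
  have := F.prop 1 t x
  simpa using this

theorem IsEquivariantlyHomotopicId.comp {f g : C(X, X)} (hg : IsEquivariantlyHomotopicId G g)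
    (hf : IsEquivariantlyHomotopicId G f) : IsEquivariantlyHomotopicId G (g.comp f) := by
  have hfs := hf.map_smul
  obtain ⟨F⟩ := hg
  refine ContinuousMap.HomotopicWith.trans hf ⟨⟨⟨⟨fun z => F (z.1, f z.2), ?_⟩, ?_, ?_⟩, ?_⟩⟩
  · exact F.continuous.comp (by fun_prop)
  · intro x
    simp
  · intro x
    simp
  · intro s t x
    change F (s, f (t • x)) = t • F (s, f x)
    rw [hfs]
    exact F.prop s t (f x)

/-- The preimage of a categorical set under a map equivariantly homotopic to the identity is
categorical. -/
theorem IsGCategorical.preimage {f : C(X, X)} (hf : IsEquivariantlyHomotopicId G f) {U : Set X}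
    (hU : IsGCategorical G U) : IsGCategorical G (f ⁻¹' U) := by
  have hfs := hf.map_smul
  have hinv : ∀ g : G, ∀ x ∈ f ⁻¹' U, g • x ∈ f ⁻¹' U := fun g x hx => by
    rw [mem_preimage, hfs]
    exact hU.invariant g _ hx
  obtain ⟨F⟩ := hf
  obtain ⟨H, hHs, hH0, z, hz⟩ := hU.exists_homotopy
  let Q : C(f ⁻¹' U, X) → Prop := fun k => ∀ (g : G) (x : f ⁻¹' U),
    k ⟨g • (x : X), hinv g x x.2⟩ = g • k x
  let r : C(f ⁻¹' U, U) := ⟨fun x => ⟨f x, x.2⟩, by fun_prop⟩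
  let k₀ : C(f ⁻¹' U, X) := ⟨Subtype.val, by fun_prop⟩
  let k₁ : C(f ⁻¹' U, X) := ⟨fun x => f x, by fun_prop⟩
  let k₂ : C(f ⁻¹' U, X) := ⟨fun x => H (r x, 1), by fun_prop⟩
  have h₁ : k₀.HomotopicWith k₁ Q := by
    refine ⟨⟨⟨⟨fun z => F (z.1, z.2), F.continuous.comp (by fun_prop)⟩, ?_, ?_⟩, ?_⟩⟩
    · intro x
      simp [k₀]
    · intro x
      simp [k₁]
    · intro s g x
      exact F.prop s g x
  have h₂ : k₁.HomotopicWith k₂ Q := by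
    refine ⟨⟨⟨⟨fun z => H (r z.2, z.1), by fun_prop⟩, ?_, ?_⟩, ?_⟩⟩
    · intro x
      exact hH0 _
    · intro x
      rfl
    · intro s g x
      change H (r _, s) = g • H (r x, s)
      rw [hHs]
      congr 2
      exact Subtype.ext (hfs g x)
  obtain ⟨K⟩ := h₁.trans h₂
  refine ⟨hU.isOpen.preimage f.continuous, hinv, ⟨fun z => K (z.2, z.1),
    K.continuous.comp (by fun_prop)⟩, fun g x t => (K.prop t g x).symm, fun x => ?_, z, fun x => ?_⟩
  · exact K.apply_zero x
  · have := K.apply_one x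
    change K (1, x) ∈ _
    rw [this]
    exact hz _

/-- The product of two categorical sets, one of which contains a fixed point, is categorical. -/
theorem IsGCategorical.prod {Y : Type*} [TopologicalSpace Y] [MulAction G Y] {U : Set X}
    {V : Set Y} (hU : IsGCategorical G U) (hV : IsGCategorical G V)
    {x : X} (hx : x ∈ U) (hxG : x ∈ MulAction.fixedPoints G X) : IsGCategorical G (U ×ˢ V) := by
  obtain ⟨H, hHs, hH0, z, hz⟩ := hU.exists_homotopy
  obtain ⟨K, hKs, hK0, w, hw⟩ := hV.exists_homotopy
  -- The homotopy sends `x` to a fixed point of the orbit of `z`, so this orbit is a single point.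
  have hzG : ∀ g : G, g • z = z := by
    obtain ⟨a, ha⟩ := hz ⟨x, hx⟩
    have hfix : ∀ g : G, g • a • z = a • z := fun g => by
      have h1 := hHs g ⟨x, hx⟩ 1
      have h2 : (⟨g • x, hU.invariant g x hx⟩ : U) = ⟨x, hx⟩ := Subtype.ext (hxG g)
      rw [h2] at h1
      rw [show a • z = H (⟨x, hx⟩, 1) from ha]
      exact h1
    intro g
    have := hfix (a * g * a⁻¹)
    rwa [mul_smul, inv_smul_smul, mul_smul, smul_left_cancel_iff] at this
  let r : C(↥(U ×ˢ V) × I, U × I) := ⟨fun p => (⟨p.1.1.1, p.1.2.1⟩, p.2), by fun_prop⟩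
  let r' : C(↥(U ×ˢ V) × I, V × I) := ⟨fun p => (⟨p.1.1.2, p.1.2.2⟩, p.2), by fun_prop⟩
  refine ⟨hU.isOpen.prod hV.isOpen,
    fun g p hp => ⟨hU.invariant g _ hp.1, hV.invariant g _ hp.2⟩,
    (H.comp r).prodMk (K.comp r'), fun g p t => Prod.ext (hHs g _ t) (hKs g _ t),
    fun p => Prod.ext (hH0 _) (hK0 _), (z, w), fun p => ?_⟩
  obtain ⟨a, ha⟩ := hz ⟨p.1.1, p.2.1⟩
  obtain ⟨b, hb⟩ := hw ⟨p.1.2, p.2.2⟩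
  -- The diagonal action admits only one group element; the one needed for `w` serves, as `z` is
  -- fixed by all.
  refine ⟨b, Prod.ext ?_ hb⟩
  refine Eq.trans ?_ ha
  change b • z = a • z
  rw [hzG, hzG]

/-- A categorical set meets a finite set of fixed points in at most one point. -/
theorem IsGCategorical.eq_of_mem_fixedPoints [T1Space X]
    (hfin : (MulAction.fixedPoints G X).Finite) {U : Set X} (hU : IsGCategorical G U) {x y : X}
    (hx : x ∈ U) (hy : y ∈ U) (hxG : x ∈ MulAction.fixedPoints G X)
    (hyG : y ∈ MulAction.fixedPoints G X) : x = y := by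
  obtain ⟨H, hHs, hH0, z, hz⟩ := hU.exists_homotopy
  have hconst : ∀ x (hx : x ∈ U), x ∈ MulAction.fixedPoints G X → z = x := by
    intro x hx hxG
    have hmem : ∀ t, H (⟨x, hx⟩, t) ∈ MulAction.fixedPoints G X := fun t g => by
      have h2 : (⟨g • x, hU.invariant g x hx⟩ : U) = ⟨x, hx⟩ := Subtype.ext (hxG g)
      rw [hHs, h2]
    have hsub : (range fun t => H (⟨x, hx⟩, t)).Subsingleton := by
      have hpre : IsPreconnected (range fun t => H (⟨x, hx⟩, t)) :=
        isPreconnected_range (by fun_prop)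
      exact hpre.isDiscrete_iff_subsingleton.1
        (hfin.subset (range_subset_iff.2 hmem)).isDiscrete
    have h1 : H (⟨x, hx⟩, 1) = x :=
      (hsub (mem_range_self 1) (mem_range_self 0)).trans (hH0 ⟨x, hx⟩)
    obtain ⟨a, ha⟩ := hz ⟨x, hx⟩
    rw [h1] at ha
    have ha' : a • z = x := ha
    have := hxG a⁻¹
    rwa [← ha', inv_smul_smul, ha'] at this
  exact (hconst x hx hxG).symm.trans (hconst y hy hyG)

/-- If a space is covered by categorical sets indexed by its fixed points, then the
equivariant category is the number of fixed points. -/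
theorem equivariantCat_eq_ncard [T1Space X] (hfin : (MulAction.fixedPoints G X).Finite)
    (hcover : ∃ U : MulAction.fixedPoints G X → Set X, (∀ x, IsGCategorical G (U x)) ∧
      ⋃ x, U x = univ) :
    equivariantCat G X = ((MulAction.fixedPoints G X).ncard : ℕ∞) := by
  have := hfin.to_subtype
  refine le_antisymm (sInf_le ?_) (le_sInf ?_)
  · obtain ⟨U, hU, hUc⟩ := hcover
    let e := Finite.equivFin (MulAction.fixedPoints G X)
    refine ⟨_, rfl, fun i => U (e.symm i), fun i => hU _, ?_⟩
    rw [← hUc]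
    exact e.symm.surjective.iUnion_comp U
  · rintro _ ⟨k, rfl, U, hU, hUc⟩
    have hex : ∀ x : MulAction.fixedPoints G X, ∃ i, (x : X) ∈ U i := fun x =>
      mem_iUnion.1 (hUc ▸ mem_univ (x : X))
    choose i hi using hex
    have hinj : Function.Injective i := fun x y hxy =>
      Subtype.ext ((hU (i x)).eq_of_mem_fixedPoints hfin (hi x) (hxy ▸ hi y) x.2 y.2)
    have := Nat.card_le_card_of_injective i hinj
    rw [Nat.card_fin] at this
    exact_mod_cast this

end Equivariant

/-! ### Equivariant pushes towards a vertex. -/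

section StarMove

variable {n : ℕ} {M : Type*} [TopologicalSpace M] [MulAction (Torus n) M]
  {P : Set (EuclideanSpace ℝ (Fin n))} {q : M → EuclideanSpace ℝ (Fin n)}

/-- An equivariant self-map of `M`, equivariantly homotopic to the identity, which covers a map of
the orbit space moving each point towards `v`, by the fraction `μ` of its distance to `v`. -/
structure IsStarMove (q : M → EuclideanSpace ℝ (Fin n)) (v : EuclideanSpace ℝ (Fin n))
    (f : C(M, M)) (μ : C(M, ℝ)) : Prop where
  homotopicId : IsEquivariantlyHomotopicId (Torus n) f
  mem_Icc : ∀ x, μ x ∈ Icc (0 : ℝ) 1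
  map_eq : ∀ x, q (f x) = q x + μ x • (v - q x)

theorem IsStarMove.id (q : M → EuclideanSpace ℝ (Fin n)) (v : EuclideanSpace ℝ (Fin n)) :
    IsStarMove q v (ContinuousMap.id M) 0 :=
  ⟨.refl, fun _ => by simp, fun _ => by simp⟩

/-- The remaining fractions of the distance to `v`, namely `1 - μ` and `1 - ν ∘ f`, multiply. -/
theorem IsStarMove.comp {v : EuclideanSpace ℝ (Fin n)} {f g : C(M, M)} {μ ν : C(M, ℝ)}
    (hg : IsStarMove q v g ν) (hf : IsStarMove q v f μ) :
    IsStarMove q v (g.comp f) (1 - (1 - ν.comp f) * (1 - μ)) := by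
  refine ⟨hg.homotopicId.comp hf.homotopicId, fun x => ?_, fun x => ?_⟩
  · obtain ⟨h0, h1⟩ := hf.mem_Icc x
    obtain ⟨h0', h1'⟩ := hg.mem_Icc (f x)
    simp only [ContinuousMap.sub_apply, ContinuousMap.mul_apply, ContinuousMap.one_apply,
      ContinuousMap.comp_apply]
    constructor <;> nlinarith [mul_nonneg (sub_nonneg.2 h1) (sub_nonneg.2 h1'),
      mul_le_one₀ (sub_le_self 1 h0) (sub_nonneg.2 h1') (sub_le_self 1 h0')]
  · simp only [ContinuousMap.sub_apply, ContinuousMap.mul_apply, ContinuousMap.one_apply,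
      ContinuousMap.comp_apply, hg.map_eq, hf.map_eq]
    module

/-- Local star moves exist wherever the faces not containing `v` are avoided. -/
theorem exists_isStarMove_nhds [CompactSpace M] (hq : IsOrbitProjection P q) (hP : Convex ℝ P)
    {v : EuclideanSpace ℝ (Fin n)} (hv : v ∈ P) {C : Set (EuclideanSpace ℝ (Fin n))}
    (hC : IsClosed C) (hCv : ∀ p ∉ C, ∀ F, IsPolytopeFace P F → p ∈ F → v ∈ F)
    {ψ : OpenPartialHomeomorph M (Fin n → ℂ)} {δ : Torus n ≃ₜ* Torus n}
    (h : IsStandardChart ψ δ) {y : M} (hy : y ∈ ψ.source) (hyC : q y ∉ C) :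
    ∃ S ∈ 𝓝 (q y), ∃ f μ, IsStarMove q v f μ ∧ ∀ x, q x ∈ S → 0 < μ x := by
  obtain ⟨ρ, hρc, hρ⟩ := hq.exists_radius h
  have hev : ∀ᶠ p in 𝓝 (q y), (∀ x, q x = p → x ∈ ψ.source) ∧ p ∉ C := by
    refine (hq.eventually_mem ψ.open_source fun x hx => ?_).and (hC.isOpen_compl.mem_nhds hyC)
    obtain ⟨t, rfl⟩ := (hq.eq_iff _ _).1 hx
    exact h.smul_mem_source t y hy
  obtain ⟨r', hr', hball⟩ := Metric.eventually_nhds_iff.1 hev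
  obtain ⟨r, hr, rfl⟩ : ∃ r, 0 < r ∧ r' = 2 * r := ⟨r' / 2, by positivity, by ring⟩
  -- Small enough that a point within `r` of `q y` moves by less than `r`, remaining in the ball of
  -- radius `2 * r` over which the chart is defined.
  set c : ℝ := r / (‖v - q y‖ + 2 * r) with hc
  have hden : 0 < ‖v - q y‖ + 2 * r := by positivity
  have hc0 : 0 < c := by positivity
  have hc1 : c < 1 := by
    rw [hc, div_lt_one hden]
    linarith [norm_nonneg (v - q y)]
  have hcr : c * (‖v - q y‖ + r) < r := by
    rw [hc, div_mul_eq_mul_div, div_lt_iff₀ hden]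
    nlinarith
  let l : EuclideanSpace ℝ (Fin n) → ℝ := fun p => c * max 0 (1 - dist p (q y) / r)
  have hl : Continuous l := by fun_prop
  have hl0 : ∀ p, 0 ≤ l p := fun p => mul_nonneg hc0.le (le_max_left _ _)
  have hlc : ∀ p, l p ≤ c := fun p => by
    refine mul_le_of_le_one_right hc0.le (max_le zero_le_one ?_)
    have : 0 ≤ dist p (q y) / r := by positivity
    linarith
  have hlpos : ∀ p, dist p (q y) < r → 0 < l p := fun p hp => by
    refine mul_pos hc0 (lt_max_of_lt_right ?_)
    rw [sub_pos, div_lt_one hr]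
    exact hp
  have hlzero : ∀ p, r ≤ dist p (q y) → l p = 0 := fun p hp => by
    have : 1 - dist p (q y) / r ≤ 0 := by
      rw [sub_nonpos, one_le_div hr]
      exact hp
    simp only [l, max_eq_left this, mul_zero]
  have hqP : ∀ x, q x ∈ P := fun x => hq.range_eq ▸ mem_range_self x
  let m : I × M → EuclideanSpace ℝ (Fin n) := fun z =>
    q z.2 + ((z.1 : ℝ) * l (q z.2)) • (v - q z.2)
  have hqc := hq.continuous
  have hm : Continuous m := by fun_prop
  have hmlt : ∀ s x, dist (q x) (q y) < r → dist (m (s, x)) (q y) < 2 * r := by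
    intro s x hx
    have h1 : ‖v - q x‖ ≤ ‖v - q y‖ + r := by
      have := dist_triangle v (q y) (q x)
      rw [dist_eq_norm, dist_eq_norm, dist_comm] at this
      linarith
    have h2 : dist (m (s, x)) (q x) ≤ c * (‖v - q y‖ + r) := by
      simp only [m, dist_eq_norm, add_sub_cancel_left, norm_smul]
      rw [Real.norm_of_nonneg (mul_nonneg s.2.1 (hl0 _))]
      refine mul_le_mul ?_ h1 (norm_nonneg _) hc0.le
      exact (mul_le_of_le_one_left (hl0 _) s.2.2).trans (hlc _)
    linarith [dist_triangle (m (s, x)) (q x) (q y)]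
  have hmP : ∀ s x, m (s, x) ∈ P := by
    intro s x
    have h1 : (s : ℝ) * l (q x) ≤ 1 :=
      (mul_le_of_le_one_left (hl0 _) s.2.2).trans ((hlc _).trans hc1.le)
    exact hP.add_smul_sub_mem (hqP x) hv ⟨mul_nonneg s.2.1 (hl0 _), h1⟩
  have hmsource : ∀ s, ∀ x ∈ ψ.source, m (s, x) ∈ q '' ψ.source := by
    intro s x hx
    rcases lt_or_ge (dist (q x) (q y)) r with hlt | hge
    · have hrange := hmP s x
      rw [← hq.range_eq] at hrange
      obtain ⟨w, hw⟩ := hrange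
      exact ⟨w, (hball (hmlt s x hlt)).1 w hw, hw⟩
    · refine ⟨x, hx, ?_⟩
      simp [m, hlzero _ hge]
  have hmzero : ∀ s, ∀ x ∈ ψ.source, ∀ i, ψ x i = 0 → ρ (m (s, x)) i = 0 := by
    intro s x hx i hi
    rcases lt_or_ge (dist (q x) (q y)) r with hlt | hge
    -- The points `w s` need not vary continuously with `s`; only their images under `q` do, and
    -- this suffices.
    · choose w hw hwm using fun s => hmsource s x hx
      have hw0 : q (w 0) = q x := by
        rw [hwm]
        simp [m]
      have hdim : ∀ s, orbitDim (n := n) x = orbitDim (n := n) (w s) := by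
        intro s
        have hxC : q x ∉ C := (hball (show dist (q x) (q y) < 2 * r by linarith)).2
        exact hq.orbitDim_eq_of_eq_add_smul hP (hCv _ hxC)
          ⟨mul_nonneg s.2.1 (hl0 _),
            ((mul_le_of_le_one_left (hl0 _) s.2.2).trans (hlc _)).trans_lt hc1⟩ (hwm s)
      have hwi : ψ (w 0) i = 0 := by
        rw [← norm_eq_zero, ← hρ _ (hw 0), hw0, hρ x hx, hi, norm_zero]
      have := h.apply_eq_zero_of_path hρc hρ hw (by simp only [hwm]; fun_prop)
        (fun s => (hdim s).symm.trans (hdim 0)) hwi s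
      rw [← hwm, hρ _ (hw s), this, norm_zero]
    · simp [m, hlzero _ hge, hρ x hx, hi]
  obtain ⟨Φ, hΦ0, hΦq, hΦs⟩ := hq.exists_lift h hρc hρ hm
    (fun s t x => by simp only [m, hq.map_smul]) (fun x => by simp [m]) hmsource hmzero
    (A := q ⁻¹' Metric.closedBall (q y) r) (Metric.isClosed_closedBall.preimage hq.continuous)
    (fun x hx => (hball (show dist (q x) (q y) < 2 * r by
      linarith [Metric.mem_closedBall.1 hx])).1 x rfl)
    (fun s x hx => by
      have hge : r ≤ dist (q x) (q y) := (not_le.1 hx).le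
      simp [m, hlzero _ hge])
  refine ⟨Metric.ball (q y) r, Metric.ball_mem_nhds _ hr,
    ⟨fun x => Φ (1, x), by fun_prop⟩, ⟨fun x => l (q x), by fun_prop⟩, ⟨?_, ?_, ?_⟩, ?_⟩
  · exact ⟨⟨⟨Φ, hΦ0, fun x => rfl⟩, hΦs⟩⟩
  · exact fun x => ⟨hl0 _, (hlc _).trans hc1.le⟩
  · intro x
    change q (Φ (1, x)) = _
    simp [hΦq, m]
  · exact fun x hx => hlpos _ hx

/-- Compactness reduces to local moves, and composition handles unions. -/
theorem exists_isStarMove_of_isCompact [CompactSpace M] (hq : IsOrbitProjection P q)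
    (hP : Convex ℝ P) {v : EuclideanSpace ℝ (Fin n)} (hv : v ∈ P)
    {C : Set (EuclideanSpace ℝ (Fin n))} (hC : IsClosed C)
    (hCv : ∀ p ∉ C, ∀ F, IsPolytopeFace P F → p ∈ F → v ∈ F)
    (hchart : ∀ y : M, ∃ (ψ : OpenPartialHomeomorph M (Fin n → ℂ)) (δ : Torus n ≃ₜ* Torus n),
      y ∈ ψ.source ∧ IsStandardChart ψ δ)
    {K : Set (EuclideanSpace ℝ (Fin n))} (hK : IsCompact K) (hKP : K ⊆ P) (hKC : Disjoint K C) :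
    ∃ f μ, IsStarMove q v f μ ∧ ∀ x, q x ∈ K → 0 < μ x := by
  refine hK.induction_on ?_ ?_ ?_ ?_
  · exact ⟨_, _, .id q v, fun x hx => hx.elim⟩
  · rintro S T hST ⟨f, μ, hf, hμ⟩
    exact ⟨f, μ, hf, fun x hx => hμ x (hST hx)⟩
  · rintro S T ⟨f, μ, hf, hμ⟩ ⟨g, ν, hg, hν⟩
    refine ⟨_, _, hg.comp hf, fun x hx => ?_⟩
    obtain ⟨h0, h1⟩ := hf.mem_Icc x
    obtain ⟨h0', h1'⟩ := hg.mem_Icc (f x)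
    simp only [ContinuousMap.sub_apply, ContinuousMap.mul_apply, ContinuousMap.one_apply,
      ContinuousMap.comp_apply]
    -- If the first move has fraction 0 at `x`, it does not change `q x`, so the second move still
    -- meets its own region.
    rcases h0.eq_or_lt with hz | hpos
    · have hfx : q (f x) = q x := by rw [hf.map_eq, ← hz, zero_smul, add_zero]
      have hxT : q x ∈ T := hx.resolve_left fun hxS => (hμ x hxS).ne hz
      have := hν (f x) (hfx ▸ hxT)
      rw [← hz]
      linarith
    · nlinarith
  · intro p hp
    have hpP := hKP hp
    rw [← hq.range_eq] at hpP
    obtain ⟨y, rfl⟩ := hpP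
    obtain ⟨ψ, δ, hy, h⟩ := hchart y
    obtain ⟨S, hS, hex⟩ :=
      exists_isStarMove_nhds hq hP hv hC hCv h hy (disjoint_left.1 hKC hp)
    exact ⟨S, mem_nhdsWithin_of_mem_nhds hS, hex⟩

/-- Iterating a star move compresses a star-shaped compact set to a neighbourhood of `v`. -/
theorem IsStarMove.exists_iterate [CompactSpace M] (hqc : Continuous q)
    {v : EuclideanSpace ℝ (Fin n)} {K : Set (EuclideanSpace ℝ (Fin n))} (hK : IsCompact K)
    (hstar : ∀ p ∈ K, ∀ s ∈ Icc (0 : ℝ) 1, p + s • (v - p) ∈ K)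
    {f : C(M, M)} {μ : C(M, ℝ)} (hf : IsStarMove q v f μ) (hμ : ∀ x, q x ∈ K → 0 < μ x)
    {B : Set (EuclideanSpace ℝ (Fin n))} (hB : B ∈ 𝓝 v) :
    ∃ g : C(M, M), IsEquivariantlyHomotopicId (Torus n) g ∧ ∀ x, q x ∈ K → q (g x) ∈ B := by
  obtain ⟨c, hc0, hc1, hc⟩ : ∃ c : ℝ, 0 < c ∧ c ≤ 1 ∧ ∀ x, q x ∈ K → c ≤ μ x := by
    have hKc : IsCompact (q ⁻¹' K) := (hK.isClosed.preimage hqc).isCompact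
    rcases (q ⁻¹' K).eq_empty_or_nonempty with he | hne
    · exact ⟨1, one_pos, le_rfl, fun x hx => absurd (show x ∈ q ⁻¹' K from hx) (by simp [he])⟩
    · obtain ⟨x₀, hx₀, hmin⟩ := hKc.exists_isMinOn hne μ.continuous.continuousOn
      exact ⟨μ x₀, hμ x₀ hx₀, (hf.mem_Icc x₀).2, fun x hx => hmin hx⟩
  -- Star-shapedness keeps the iterates over `K`, where each application shrinks the distance to `v`
  -- by the uniform factor `1 - c`.
  have hiter : ∀ N : ℕ, ∃ g : C(M, M), IsEquivariantlyHomotopicId (Torus n) g ∧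
      ∀ x, q x ∈ K → q (g x) ∈ K ∧ ‖q (g x) - v‖ ≤ (1 - c) ^ N * ‖q x - v‖ := by
    intro N
    induction N with
    | zero => exact ⟨ContinuousMap.id M, .refl, fun x hx => ⟨hx, by simp⟩⟩
    | succ N ih =>
      obtain ⟨g, hg, hgK⟩ := ih
      refine ⟨f.comp g, hf.homotopicId.comp hg, fun x hx => ?_⟩
      obtain ⟨hgx, hle⟩ := hgK x hx
      rw [ContinuousMap.comp_apply]
      refine ⟨hf.map_eq (g x) ▸ hstar _ hgx _ (hf.mem_Icc _), ?_⟩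
      have heq : q (f (g x)) - v = (1 - μ (g x)) • (q (g x) - v) := by
        rw [hf.map_eq]
        module
      rw [heq, norm_smul, Real.norm_of_nonneg (sub_nonneg.2 (hf.mem_Icc _).2), pow_succ',
        mul_assoc]
      exact mul_le_mul (sub_le_sub_left (hc _ hgx) 1) hle (norm_nonneg _) (sub_nonneg.2 hc1)
  obtain ⟨ε, hε, hεB⟩ := Metric.mem_nhds_iff.1 hB
  obtain ⟨R, hR⟩ := hK.isBounded.subset_closedBall v
  have hlim : Filter.Tendsto (fun N : ℕ => (1 - c) ^ N * R) Filter.atTop (𝓝 0) := by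
    simpa using (tendsto_pow_atTop_nhds_zero_of_lt_one (sub_nonneg.2 hc1)
      (sub_lt_self 1 hc0)).mul_const R
  obtain ⟨N, hN⟩ := (hlim.eventually_lt_const hε).exists
  obtain ⟨g, hg, hgK⟩ := hiter N
  refine ⟨g, hg, fun x hx => hεB ?_⟩
  rw [Metric.mem_ball, dist_eq_norm]
  refine ((hgK x hx).2.trans ?_).trans_lt hN
  refine mul_le_mul_of_nonneg_left ?_ (pow_nonneg (sub_nonneg.2 hc1) _)
  rw [← dist_eq_norm]
  exact hR hx

end StarMove

/-! ### Fixed points, vertices and linear contractions. -/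

section FixedPoints

variable {n : ℕ} {M : Type*} [TopologicalSpace M] [MulAction (Torus n) M]
  {P : Set (EuclideanSpace ℝ (Fin n))} {q : M → EuclideanSpace ℝ (Fin n)}

/-- The fixed points are the points that lie over the vertices. -/
theorem IsOrbitProjection.mem_fixedPoints_iff (hq : IsOrbitProjection P q) {x : M} :
    x ∈ MulAction.fixedPoints (Torus n) M ↔ q x ∈ P.extremePoints ℝ := by
  obtain ⟨F, hF, hFd, hFx⟩ := hq.mem_face x
  rw [← orbitDim_eq_zero_iff, ← hFd]
  refine ⟨fun h => ?_, fun h => ?_⟩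
  · obtain ⟨v, hv, rfl⟩ := hF.eq_singleton_of_convexDim_eq_zero h
    have hqv : q x ∈ ({v} : Set _) := intrinsicInterior_subset hFx
    rwa [mem_singleton_iff.1 hqv]
  · rw [hF.eq_singleton_of_mem_extremePoints h hFx, convexDim_singleton]

theorem IsOrbitProjection.eq_of_map_eq (hq : IsOrbitProjection P q) {x y : M}
    (hy : y ∈ MulAction.fixedPoints (Torus n) M) (h : q x = q y) : x = y := by
  obtain ⟨t, rfl⟩ := (hq.eq_iff _ _).1 h
  exact hy t

/-- A fixed point in a standard chart has a categorical neighbourhood. -/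
theorem IsStandardChart.exists_isGCategorical {ψ : OpenPartialHomeomorph M (Fin n → ℂ)}
    {δ : Torus n ≃ₜ* Torus n} (h : IsStandardChart ψ δ) {x : M} (hx : x ∈ ψ.source)
    (hfix : x ∈ MulAction.fixedPoints (Torus n) M) :
    ∃ O : Set M, x ∈ O ∧ IsGCategorical (Torus n) O := by
  have hx0 := h.apply_eq_zero_of_mem_fixedPoints hx hfix
  obtain ⟨ε, hε, hball⟩ := Metric.isOpen_iff.1 ψ.open_target 0 (hx0 ▸ ψ.map_source hx)
  have hnorm : ∀ (t : Torus n), ∀ y ∈ ψ.source, ‖ψ (t • y)‖ = ‖ψ y‖ := fun t y hy => by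
    have hu : ∀ u : Circle, ‖(u : ℂ)‖₊ = 1 := fun u => NNReal.eq (Circle.norm_coe u)
    simp only [h.map_smul t y hy, Pi.norm_def, nnnorm_mul, hu, one_mul]
  have hinv : ∀ t : Torus n, ∀ y ∈ ψ.source ∩ ψ ⁻¹' Metric.ball 0 ε,
      t • y ∈ ψ.source ∩ ψ ⁻¹' Metric.ball 0 ε := fun t y hy => by
    refine ⟨h.smul_mem_source t y hy.1, ?_⟩
    rw [mem_preimage, mem_ball_zero_iff, hnorm t y hy.1]
    exact mem_ball_zero_iff.1 hy.2
  -- Scaling towards the origin commutes with coordinatewise rotation and preserves the ball.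
  have hmem : ∀ z : ↥(ψ.source ∩ ψ ⁻¹' Metric.ball 0 ε) × I,
      ((1 - (z.2 : ℝ)) • ψ z.1) ∈ ψ.target := fun z => by
    refine hball (mem_ball_zero_iff.2 ?_)
    rw [norm_smul, Real.norm_of_nonneg (sub_nonneg.2 z.2.2.2)]
    exact (mul_le_of_le_one_left (norm_nonneg _) (sub_le_self 1 z.2.2.1)).trans_lt
      (mem_ball_zero_iff.1 z.1.2.2)
  have hcont : Continuous fun z : ↥(ψ.source ∩ ψ ⁻¹' Metric.ball 0 ε) × I =>
      ψ.symm ((1 - (z.2 : ℝ)) • ψ z.1) := by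
    refine ψ.continuousOn_symm.comp_continuous ?_ hmem
    have h1 : Continuous fun z : ↥(ψ.source ∩ ψ ⁻¹' Metric.ball 0 ε) × I => ψ z.1 :=
      ψ.continuousOn.comp_continuous (by fun_prop) fun z => z.1.2.1
    have h2 : Continuous fun z : ↥(ψ.source ∩ ψ ⁻¹' Metric.ball 0 ε) × I => 1 - (z.2 : ℝ) := by
      fun_prop
    exact h2.smul h1
  refine ⟨ψ.source ∩ ψ ⁻¹' Metric.ball 0 ε, ⟨hx, by simpa [hx0] using hε⟩,
    ψ.isOpen_inter_preimage Metric.isOpen_ball, hinv, ⟨_, hcont⟩, fun t y s => ?_, fun y => ?_,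
    x, fun y => ⟨1, ?_⟩⟩
  · obtain ⟨w, hw, hwz⟩ : ∃ w ∈ ψ.source, ψ w = (1 - (s : ℝ)) • ψ y :=
      ⟨_, ψ.map_target (hmem (y, s)), ψ.right_inv (hmem (y, s))⟩
    change t • ψ.symm ((1 - (s : ℝ)) • ψ y) = ψ.symm ((1 - (s : ℝ)) • ψ (t • (y : M)))
    have hsmul : (1 - (s : ℝ)) • ψ (t • (y : M)) = ψ (t • w) := by
      rw [h.map_smul t y y.2.1, h.map_smul t w hw, hwz]
      funext i
      simp only [Pi.smul_apply, mul_smul_comm]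
    rw [hsmul, ψ.left_inv (h.smul_mem_source t w hw), ← hwz, ψ.left_inv hw]
  · change ψ.symm ((1 - ((0 : I) : ℝ)) • ψ y) = y
    simp [ψ.left_inv y.2.1]
  · change (1 : Torus n) • x = ψ.symm ((1 - ((1 : I) : ℝ)) • ψ y)
    rw [one_smul, Icc.coe_one, sub_self, zero_smul, ← hx0, ψ.left_inv hx]

end FixedPoints

/-! ### The categorical cover and the main theorem. -/

namespace IsQuasitoricManifold

variable {n : ℕ} {M : Type*} [TopologicalSpace M]
  [ChartedSpace (EuclideanSpace ℝ (Fin (2 * n))) M] [MulAction (Torus n) M]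

theorem exists_isStandardChart (hM : IsQuasitoricManifold n M) (y : M) :
    ∃ (ψ : OpenPartialHomeomorph M (Fin n → ℂ)) (δ : Torus n ≃ₜ* Torus n),
      y ∈ ψ.source ∧ IsStandardChart ψ δ := by
  obtain ⟨ψ, δ, hy, hs, -, -, -, hsmul⟩ := hM.locallyStandard y
  exact ⟨ψ, δ, hy, hs, hsmul⟩

/-- A quasitoric manifold has finitely many fixed points, and it is covered by categorical sets,
one around each fixed point. -/
theorem exists_cover (hM : IsQuasitoricManifold n M) :
    (MulAction.fixedPoints (Torus n) M).Finite ∧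
    ∃ U : MulAction.fixedPoints (Torus n) M → Set M,
      (∀ x, IsGCategorical (Torus n) (U x) ∧ (x : M) ∈ U x) ∧ ⋃ x, U x = univ := by
  have := hM.compactSpace
  obtain ⟨P, hP, -, q, hq⟩ := hM.exists_polytope
  obtain ⟨s, hs, hPs⟩ := hP.exists_finite
  have hPc : Convex ℝ P := hPs ▸ convex_convexHull ℝ s
  have hPk : IsCompact P := hPs ▸ hs.isCompact_convexHull ℝ
  have hVfin : (P.extremePoints ℝ).Finite :=
    hs.subset (hPs ▸ extremePoints_convexHull_subset)
  have hVP : convexHull ℝ (P.extremePoints ℝ) = P := by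
    rw [← (hVfin.isCompact_convexHull ℝ).isClosed.closure_eq]
    exact closure_convexHull_extremePoints hPk hPc
  refine ⟨?_, ?_⟩
  · refine Set.Finite.of_finite_image (f := q) (hVfin.subset ?_) fun x _ y hy h =>
      hq.eq_of_map_eq hy h
    rintro _ ⟨x, hx, rfl⟩
    exact hq.mem_fixedPoints_iff.1 hx
  · obtain ⟨K, hK, hcover⟩ := exists_isCompact_star_cover hVfin
    rw [hVP] at hK hcover
    have hU : ∀ x : MulAction.fixedPoints (Torus n) M, ∃ U : Set M,
        IsGCategorical (Torus n) U ∧ ∀ y, q y ∈ K (q x) → y ∈ U := by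
      rintro ⟨x, hx⟩
      have hv := hq.mem_fixedPoints_iff.1 hx
      obtain ⟨hKc, hKP, -, hstar, hKF⟩ := hK _ hv
      obtain ⟨ψ, δ, hxψ, h⟩ := hM.exists_isStandardChart x
      obtain ⟨O, hxO, hO⟩ := h.exists_isGCategorical hxψ hx
      have hB := hq.eventually_mem (p := q x) hO.isOpen fun y hy =>
        (hq.eq_of_map_eq hx hy) ▸ hxO
      -- The set to be avoided is the union of the faces missing the vertex; it is closed because
      -- there are finitely many faces.
      have hCclosed : IsClosed (⋃ F ∈ {F | IsPolytopeFace P F ∧ q x ∉ F}, F) :=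
        ((finite_setOf_isPolytopeFace hPk hPc hVfin).subset fun F hF => hF.1).isClosed_biUnion
          fun F hF => hF.1.2.isClosed hPk.isClosed
      obtain ⟨f, μ, hf, hμ⟩ := exists_isStarMove_of_isCompact hq hPc hv.1 hCclosed
        (fun p hp F hF hpF => by
          by_contra hxF
          exact hp (mem_biUnion (show F ∈ {F | IsPolytopeFace P F ∧ q x ∉ F} from ⟨hF, hxF⟩) hpF))
        hM.exists_isStandardChart hKc hKP (by
          refine disjoint_left.2 fun p hpK hpC => ?_
          obtain ⟨F, hF, hpF⟩ := mem_iUnion₂.1 hpC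
          exact hF.2 (hKF F p hF.1 hpF hpK))
      obtain ⟨g, hg, hgB⟩ := hf.exists_iterate hq.continuous hKc hstar hμ hB
      exact ⟨g ⁻¹' O, hO.preimage hg, fun y hy => hgB y hy (g y) rfl⟩
    choose U hU hUK using hU
    refine ⟨U, fun x => ⟨hU x, hUK x x (hK _ (hq.mem_fixedPoints_iff.1 x.2)).2.2.1⟩, ?_⟩
    refine eq_univ_of_forall fun y => ?_
    obtain ⟨v, hv, hyv⟩ := hcover (q y) (hq.range_eq ▸ mem_range_self y)
    have hvP : v ∈ P := hv.1
    rw [← hq.range_eq] at hvP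
    obtain ⟨x, rfl⟩ := hvP
    exact mem_iUnion.2 ⟨⟨x, hq.mem_fixedPoints_iff.2 hv⟩, hUK _ y hyv⟩

end IsQuasitoricManifold

theorem MulAction.fixedPoints_prod (G X Y : Type*) [Group G] [MulAction G X] [MulAction G Y] :
    fixedPoints G (X × Y) = fixedPoints G X ×ˢ fixedPoints G Y := by
  ext p
  simp only [mem_fixedPoints, mem_prod, Prod.ext_iff, Prod.smul_fst, Prod.smul_snd, forall_and]

theorem mainTheorem7 (n : ℕ)
    (M : Type*) [TopologicalSpace M] [ChartedSpace (EuclideanSpace ℝ (Fin (2 * n))) M]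
    [MulAction (Torus n) M] (hM : IsQuasitoricManifold n M)
    (N : Type*) [TopologicalSpace N] [ChartedSpace (EuclideanSpace ℝ (Fin (2 * n))) N]
    [MulAction (Torus n) N] (hN : IsQuasitoricManifold n N) :
    (MulAction.fixedPoints (Torus n) M).Finite ∧
    (MulAction.fixedPoints (Torus n) N).Finite ∧
    equivariantCat (Torus n) (M × N) =
      (((MulAction.fixedPoints (Torus n) M).ncard *
        (MulAction.fixedPoints (Torus n) N).ncard : ℕ) : ℕ∞) := by
  have := hM.t2Space
  have := hN.t2Space
  obtain ⟨hMfin, U, hU, hUc⟩ := hM.exists_cover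
  obtain ⟨hNfin, V, hV, hVc⟩ := hN.exists_cover
  have hprod := MulAction.fixedPoints_prod (Torus n) M N
  refine ⟨hMfin, hNfin, ?_⟩
  rw [equivariantCat_eq_ncard (hprod ▸ hMfin.prod hNfin), hprod, ncard_prod]
  have hfst : ∀ p : MulAction.fixedPoints (Torus n) (M × N),
      p.1 ∈ MulAction.fixedPoints (Torus n) M ×ˢ MulAction.fixedPoints (Torus n) N :=
    fun p => hprod ▸ p.2
  refine ⟨fun p => U ⟨p.1.1, (hfst p).1⟩ ×ˢ V ⟨p.1.2, (hfst p).2⟩,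
    fun p => (hU _).1.prod (hV _).1 (hU _).2 (hfst p).1, eq_univ_of_forall fun z => ?_⟩
  obtain ⟨x, hx⟩ := mem_iUnion.1 (hUc ▸ mem_univ z.1)
  obtain ⟨y, hy⟩ := mem_iUnion.1 (hVc ▸ mem_univ z.2)
  exact mem_iUnion.2 ⟨⟨(x, y), hprod.symm ▸ mk_mem_prod x.2 y.2⟩, hx, hy⟩
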